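/- All manifolds, vector bundles, sections and maps are smooth and real; manifolds are finite-dimensional, Hausdorff, second countable and without boundary, and vector bundles have finite rank. **Courant algebroids.** A Courant algebroid over a manifold $M$ is a vector bundle $\mathbb{E}\to M$ with a bundle map $\mathbf{a}:\mathbb{E}\to TM$, a bundle metric $\langle\cdot,\cdot\rangle$ (non-degenerate, symmetric, not necessarily positive definite), and an $\mathbb{R}$-bilinear bracket $[\![\cdot,\cdot]\!]$ on $\Gamma(\mathbb{E})$ (the Courant bracket) such that for all sections $\sigma_i\in\Gamma(\mathbb{E})$ - $[\![\sigma_1,[\![\sigma_2,\sigma_3]\!]]\!]=[\![[\![\sigma_1,\sigma_2]\!],\sigma_3]\!]+[\![\sigma_2,[\![\sigma_1,\sigma_3]\!]]\!]$, - $\mathbf{a}(\sigma_1)\langle\sigma_2,\sigma_3\rangle=\langle[\![\sigma_1,\sigma_2]\!],\sigma_3\rangle+\langle\sigma_2,[\![\sigma_1,\sigma_3]\!]\rangle$, - $[\![\sigma_1,\sigma_2]\!]+[\![\sigma_2,\sigma_1]\!]=\mathbf{a}^*(d\langle\sigma_1,\sigma_2\rangle)$, where $\mathbf{a}^*:T^*M\to\mathbb{E}^*\cong\mathbb{E}$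 is dual to $\mathbf{a}$, i.e. $\langle\mathbf{a}^*\alpha,w\rangle=\alpha(\mathbf{a}(w))$. **Pseudo-connections.** A pseudo-connection for a subbundle $W\subseteq\mathbb{E}$ is a map $\nabla:\Gamma(W)\to\Omega^1(M,W^*)$ such that for all $\sigma,\tau\in\Gamma(W)$ and $f\in C^\infty(M)$ $$\nabla(f\sigma)=f\nabla\sigma+df\otimes\langle\sigma,\cdot\rangle,\qquad d\langle\sigma,\tau\rangle=\langle\nabla\sigma,\tau\rangle+\langle\sigma,\nabla\tau\rangle,$$ where $\langle\nabla\sigma,\tau\rangle=\langle\tau,\nabla\sigma\rangle\in\Omega^1(M)$ is the pairing of $W^*$ with $W$. The modified bracket of $\sigma,\tau\in\Gamma(W)$ is $$[\sigma,\tau]:=[\![\sigma,\tau]\!]-\mathbf{a}^*\langle\nabla\sigma,\tau\rangle\in\Gamma(\mathbb{E}),$$ and for $\sigma,\tau,\upsilon\in\Gamma(W)$ one sets $T(\sigma,\tau,\upsilon)=\langle\nabla_{\mathbf{a}(\sigma)}\tau-\nabla_{\mathbf{a}(\tau)}\sigma-[\sigma,\tau],\upsilon\rangle\in C^\infty(M)$.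 **Pseudo-Dirac structures.** A pseudo-Dirac structure $(W,\nabla)$ in $\mathbb{E}$ is a subbundle $W\subseteq\mathbb{E}$ with a pseudo-connection $\nabla$ for $W$ such that $[\sigma,\tau]\in\Gamma(W)$ for all $\sigma,\tau\in\Gamma(W)$, and for all $\sigma,\tau,\upsilon\in\Gamma(W)$ the one-form $$\Psi(\sigma,\tau,\upsilon)=\langle[\sigma,\tau],\nabla\upsilon\rangle+\langle[\upsilon,\sigma],\nabla\tau\rangle+\langle[\tau,\upsilon],\nabla\sigma\rangle+\iota_{\mathbf{a}(\sigma)}d\langle\nabla\tau,\upsilon\rangle+\iota_{\mathbf{a}(\upsilon)}d\langle\nabla\sigma,\tau\rangle+\iota_{\mathbf{a}(\tau)}d\langle\nabla\upsilon,\sigma\rangle+d\,T(\sigma,\tau,\upsilon)$$ vanishes. **Proposition.** Let $(W,\nabla)$ be a pseudo-Dirac structure in a Courant algebroid $\mathbb{E}\to M$. If $\sigma,\tau\in\Gamma(W)$ satisfy $\nabla\sigma=\nabla\tau=0$, then - $[\![\sigma,\tau]\!]=[\sigma,\tau]$; in particular $[\![\sigma,\tau]\!]\in\Gamma(W)$;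 - $\nabla[\![\sigma,\tau]\!]=0$. Consequently $\{\sigma\in\Gamma(W):\nabla\sigma=0\}$ is a linear subspace of $\Gamma(W)$, closed under the Courant bracket, and with this bracket it is a real Lie algebra. -/

import Mathlib

open scoped Manifold ContDiff Bundle Topology

noncomputable section

namespace PseudoDirac

variable {E : Type*} [NormedAddCommGroup E] [NormedSpace ℝ E]
  {H : Type*} [TopologicalSpace H] (I : ModelWithCorners ℝ E H)
  {M : Type*} [TopologicalSpace M] [ChartedSpace H M]

/-- A (not necessarily smooth) differential one-form on `M`, as a field of covectors. -/
abbrev OneForm : Type _ := ∀ x : M, TangentSpace I x →L[ℝ] ℝ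

/-- The one-form `α` read in the preferred chart at `x₀`: the field of covectors
`y ↦ α_{φ⁻¹(y)} ∘ D(φ⁻¹)_y` on the model space, where `φ = extChartAt I x₀`. -/
def OneForm.inChart (α : OneForm (M := M) I) (x₀ : M) (y : E) : E →L[ℝ] ℝ :=
  (α ((extChartAt I x₀).symm y)).comp
    (mfderivWithin 𝓘(ℝ, E) I (extChartAt I x₀).symm (Set.range I) y)

/-- The exterior derivative of a one-form: `dα_x(v, w) = D_v α̃(w) - D_w α̃(v)`, where `α̃` is `α`
read in the preferred chart at `x`. (The normalization without a factor `1/2`, i.e.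
`dα(X, Y) = X(α(Y)) - Y(α(X)) - α([X, Y])`.) -/
def extDerivOneForm (α : OneForm (M := M) I) (x : M) (v w : TangentSpace I x) : ℝ :=
  let dφ : TangentSpace I x →L[ℝ] E := mfderiv I 𝓘(ℝ, E) (extChartAt I x) x
  let Dα : E →L[ℝ] E →L[ℝ] ℝ :=
    fderivWithin ℝ (OneForm.inChart I α x) (Set.range I) (extChartAt I x x)
  Dα (dφ v) (dφ w) - Dα (dφ w) (dφ v)

variable (F : Type*) [NormedAddCommGroup F] [NormedSpace ℝ F]
  (V : M → Type*) [TopologicalSpace (Bundle.TotalSpace F V)]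
  [∀ x, AddCommGroup (V x)] [∀ x, Module ℝ (V x)] [∀ x, TopologicalSpace (V x)]
  [FiberBundle F V] [VectorBundle ℝ F V]

/-- The fibres of a vector bundle of finite rank are finite-dimensional. -/
theorem finiteDimensional_fiber [FiniteDimensional ℝ F] (x : M) : FiniteDimensional ℝ (V x) :=
  ((trivializationAt F V x).continuousLinearEquivAt ℝ x
    (FiberBundle.mem_baseSet_trivializationAt' x)).toLinearEquiv.symm.finiteDimensional

/-- A bundle metric: a smooth field of non-degenerate (not necessarily positive definite) symmetric
bilinear forms on the fibres of `V`. -/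
structure BundleMetric where
  form : ∀ x, V x →L[ℝ] V x →L[ℝ] ℝ
  smooth : ContMDiff I (I.prod 𝓘(ℝ, F →L[ℝ] F →L[ℝ] ℝ)) ∞
    (fun x ↦ Bundle.TotalSpace.mk' (F →L[ℝ] F →L[ℝ] ℝ)
      (E := fun x ↦ V x →L[ℝ] V x →L[ℝ] ℝ) x (form x))
  symm : ∀ x v w, form x v w = form x w v
  nondegenerate : ∀ x v, (∀ w, form x v w = 0) → v = 0

/-- A smooth bundle map `V → TM` over the identity. -/
structure Anchor [IsManifold I ∞ M] where
  toFun : ∀ x, V x →L[ℝ] TangentSpace I x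
  smooth : ContMDiff I (I.prod 𝓘(ℝ, F →L[ℝ] E)) ∞
    (fun x ↦ Bundle.TotalSpace.mk' (F →L[ℝ] E)
      (E := fun x ↦ V x →L[ℝ] TangentSpace I x) x (toFun x))

variable {I F V}

/-- The isomorphism `V_x ≅ V_x^*`, `v ↦ ⟨v, ·⟩`, defined by the bundle metric. -/
def BundleMetric.toDual [FiniteDimensional ℝ F] (g : BundleMetric I F V) (x : M) :
    V x ≃ₗ[ℝ] Module.Dual ℝ (V x) :=
  haveI : FiniteDimensional ℝ (V x) := finiteDimensional_fiber F V x
  LinearMap.linearEquivOfInjective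
    ({ toFun := fun v ↦ (g.form x v : V x →ₗ[ℝ] ℝ)
       map_add' := fun v w ↦ by ext; simp
       map_smul' := fun c v ↦ by ext; simp } : V x →ₗ[ℝ] Module.Dual ℝ (V x))
    ((injective_iff_map_eq_zero _).2 fun v hv ↦
      g.nondegenerate x v fun w ↦ LinearMap.congr_fun hv w)
    Subspace.dual_finrank_eq.symm

/-- The map `a^* : T^*M → V^* ≅ V` dual to the anchor, where `V^* ≅ V` through the bundle metric. -/
def coanchor [IsManifold I ∞ M] [FiniteDimensional ℝ F] (g : BundleMetric I F V)
    (a : Anchor I F V) (x : M) (α : TangentSpace I x →L[ℝ] ℝ) : V x :=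
  (g.toDual x).symm (α.comp (a.toFun x) : V x →ₗ[ℝ] ℝ)

/-- The defining property `⟨a^* α, w⟩ = α(a(w))` of the dual of the anchor. -/
theorem form_coanchor [IsManifold I ∞ M] [FiniteDimensional ℝ F] (g : BundleMetric I F V)
    (a : Anchor I F V) (x : M) (α : TangentSpace I x →L[ℝ] ℝ) (w : V x) :
    g.form x (coanchor g a x α) w = α (a.toFun x w) :=
  LinearMap.congr_fun ((g.toDual x).apply_symm_apply (α.comp (a.toFun x) : V x →ₗ[ℝ] ℝ)) w

variable (I F V) in
/-- A Courant algebroid structure on the vector bundle `V → M`: an anchor, a bundle metric and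
an `ℝ`-bilinear bracket on the space of smooth sections, satisfying the Jacobi identity
(in Leibniz form), invariance of the metric, and skew-symmetry up to the exact term `a^* d⟨σ₁, σ₂⟩`. -/
structure CourantAlgebroid [IsManifold I ∞ M] [FiniteDimensional ℝ F] where
  metric : BundleMetric I F V
  anchor : Anchor I F V
  bracket : Cₛ^∞⟮I; F, V⟯ →ₗ[ℝ] Cₛ^∞⟮I; F, V⟯ →ₗ[ℝ] Cₛ^∞⟮I; F, V⟯
  c1 : ∀ σ₁ σ₂ σ₃, bracket σ₁ (bracket σ₂ σ₃) =
    bracket (bracket σ₁ σ₂) σ₃ + bracket σ₂ (bracket σ₁ σ₃)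
  c2 : ∀ σ₁ σ₂ σ₃ x,
    mvfderiv I (fun y ↦ metric.form y (σ₂ y) (σ₃ y)) x (anchor.toFun x (σ₁ x)) =
      metric.form x (bracket σ₁ σ₂ x) (σ₃ x) + metric.form x (σ₂ x) (bracket σ₁ σ₃ x)
  c3 : ∀ σ₁ σ₂ x, bracket σ₁ σ₂ x + bracket σ₂ σ₁ x =
    coanchor metric anchor x (mvfderiv I (fun y ↦ metric.form y (σ₁ y) (σ₂ y)) x)

variable (I F V) in
/-- A smooth subbundle of `V`: a field of subspaces of the fibres that is locally spanned by a
smooth frame. (Its rank may vary from one connected component of `M` to another.) -/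
structure Subbundle where
  fiber : ∀ x, Submodule ℝ (V x)
  exists_frame : ∀ x₀, ∃ U : Set M, IsOpen U ∧ x₀ ∈ U ∧ ∃ (k : ℕ) (s : Fin k → ∀ x, V x),
    (∀ i, ContMDiffOn I (I.prod 𝓘(ℝ, F)) ∞ (fun x ↦ Bundle.TotalSpace.mk' F x (s i x)) U) ∧
    ∀ x ∈ U, LinearIndependent ℝ (fun i ↦ s i x) ∧
      Submodule.span ℝ (Set.range fun i ↦ s i x) = fiber x

/-- The space `Γ(W)` of smooth sections of a subbundle `W`, as a subspace of `Γ(V)`. -/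
def Subbundle.sections (W : Subbundle I F V) : Submodule ℝ Cₛ^∞⟮I; F, V⟯ where
  carrier := {σ | ∀ x, σ x ∈ W.fiber x}
  add_mem' hσ hτ x := (W.fiber x).add_mem (hσ x) (hτ x)
  zero_mem' x := (W.fiber x).zero_mem
  smul_mem' c _ hσ x := (W.fiber x).smul_mem c (hσ x)

/-- The value at `x` of a section of `W`, as an element of the fibre `W_x`. -/
def Subbundle.eval (W : Subbundle I F V) (σ : W.sections) (x : M) : W.fiber x :=
  ⟨(σ : Cₛ^∞⟮I; F, V⟯) x, σ.2 x⟩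

/-- The product `f σ` of a smooth function and a smooth section of `W`. -/
def Subbundle.funSMul (W : Subbundle I F V) (f : C^∞⟮I, M; 𝓘(ℝ, ℝ), ℝ⟯) (σ : W.sections) :
    W.sections :=
  ⟨⟨fun x ↦ f x • (σ : Cₛ^∞⟮I; F, V⟯) x,
      f.contMDiff.smul_section (σ : Cₛ^∞⟮I; F, V⟯).contMDiff⟩,
    fun x ↦ (W.fiber x).smul_mem (f x) (σ.2 x)⟩

/-- The function `⟨σ, τ⟩` on `M`. -/
def BundleMetric.pair (g : BundleMetric I F V) (σ τ : Cₛ^∞⟮I; F, V⟯) (x : M) : ℝ :=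
  g.form x (σ x) (τ x)

/-- A pseudo-connection for `W ⊆ V`: a map `∇ : Γ(W) → Ω¹(M, W^*)` such that
`∇(fσ) = f ∇σ + df ⊗ ⟨σ, ·⟩` and `d⟨σ, τ⟩ = ⟨∇σ, τ⟩ + ⟨σ, ∇τ⟩`. Here `toFun σ x v w` is
`⟨∇_v σ, w⟩`, for `v ∈ T_xM` and `w ∈ W_x`. Smoothness of the `W^*`-valued one-form `∇σ` is expressed
through smoothness of the functions `⟨∇_X σ, τ⟩`. -/
structure PseudoConnection [IsManifold I ∞ M] (g : BundleMetric I F V) (W : Subbundle I F V) where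
  toFun : W.sections → ∀ x : M, TangentSpace I x →ₗ[ℝ] W.fiber x →ₗ[ℝ] ℝ
  smooth : ∀ (σ τ : W.sections) (X : Cₛ^∞⟮I; E, (TangentSpace I : M → Type _)⟯),
    ContMDiff I 𝓘(ℝ, ℝ) ∞ (fun x ↦ toFun σ x (X x) (W.eval τ x))
  leibniz : ∀ (f : C^∞⟮I, M; 𝓘(ℝ, ℝ), ℝ⟯) (σ : W.sections) (x : M) (v : TangentSpace I x)
    (w : W.fiber x), toFun (W.funSMul f σ) x v w =
      f x * toFun σ x v w + mvfderiv I f x v * g.form x ((σ : Cₛ^∞⟮I; F, V⟯) x) w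
  metric_compat : ∀ (σ τ : W.sections) (x : M) (v : TangentSpace I x),
    mvfderiv I (g.pair σ τ) x v = toFun σ x v (W.eval τ x) + toFun τ x v (W.eval σ x)

/-- The one-form `⟨∇σ, τ⟩`. -/
def PseudoConnection.pairing [IsManifold I ∞ M] [FiniteDimensional ℝ E] {g : BundleMetric I F V}
    {W : Subbundle I F V} (nabla : PseudoConnection g W) (σ τ : W.sections) :
    OneForm (M := M) I :=
  fun x ↦
    haveI : FiniteDimensional ℝ (TangentSpace I x) := inferInstanceAs (FiniteDimensional ℝ E)
    haveI : T2Space (TangentSpace I x) := inferInstanceAs (T2Space E)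
    LinearMap.toContinuousLinearMap ((nabla.toFun σ x).flip (W.eval τ x))

/-- The value of `⟨∇σ, τ⟩` on `v` is `⟨∇_v σ, τ⟩`. -/
theorem PseudoConnection.pairing_apply [IsManifold I ∞ M] [FiniteDimensional ℝ E]
    {g : BundleMetric I F V} {W : Subbundle I F V} (nabla : PseudoConnection g W)
    (σ τ : W.sections) (x : M) (v : TangentSpace I x) :
    nabla.pairing σ τ x v = nabla.toFun σ x v (W.eval τ x) :=
  rfl

variable [IsManifold I ∞ M] [FiniteDimensional ℝ E] [FiniteDimensional ℝ F]

/-- The modified bracket `[σ, τ] = ⟦σ, τ⟧ - a^*⟨∇σ, τ⟩` of two sections of `W`, a section of `V`. -/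
def modifiedBracket (C : CourantAlgebroid I F V) {W : Subbundle I F V}
    (nabla : PseudoConnection C.metric W) (σ τ : W.sections) (x : M) : V x :=
  C.bracket σ τ x - coanchor C.metric C.anchor x (nabla.pairing σ τ x)

/-- The torsion `T(σ, τ, υ) = ⟨∇_{a(σ)} τ - ∇_{a(τ)} σ - [σ, τ], υ⟩`, a function on `M`. -/
def torsion (C : CourantAlgebroid I F V) {W : Subbundle I F V}
    (nabla : PseudoConnection C.metric W) (σ τ υ : W.sections) (x : M) : ℝ :=
  nabla.toFun τ x (C.anchor.toFun x ((σ : Cₛ^∞⟮I; F, V⟯) x)) (W.eval υ x)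
    - nabla.toFun σ x (C.anchor.toFun x ((τ : Cₛ^∞⟮I; F, V⟯) x)) (W.eval υ x)
    - C.metric.form x (modifiedBracket C nabla σ τ x) ((υ : Cₛ^∞⟮I; F, V⟯) x)

/-- The modified bracket takes values in sections of `W`. (The modified bracket of smooth sections
is automatically a smooth section of `V`, so membership in `Γ(W)` is a fibrewise condition.) -/
def ModifiedBracketClosed (C : CourantAlgebroid I F V) {W : Subbundle I F V}
    (nabla : PseudoConnection C.metric W) : Prop :=
  ∀ (σ τ : W.sections) (x : M), modifiedBracket C nabla σ τ x ∈ W.fiber x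

/-- The one-form
`Ψ(σ, τ, υ) = ⟨[σ,τ], ∇υ⟩ + ⟨[υ,σ], ∇τ⟩ + ⟨[τ,υ], ∇σ⟩`
`  + ι_{a(σ)} d⟨∇τ,υ⟩ + ι_{a(υ)} d⟨∇σ,τ⟩ + ι_{a(τ)} d⟨∇υ,σ⟩ + dT(σ,τ,υ)`,
evaluated on `v ∈ T_xM`. -/
def Psi (C : CourantAlgebroid I F V) {W : Subbundle I F V}
    (nabla : PseudoConnection C.metric W) (h : ModifiedBracketClosed C nabla)
    (σ τ υ : W.sections) (x : M) (v : TangentSpace I x) : ℝ :=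
  nabla.toFun υ x v ⟨modifiedBracket C nabla σ τ x, h σ τ x⟩
    + nabla.toFun τ x v ⟨modifiedBracket C nabla υ σ x, h υ σ x⟩
    + nabla.toFun σ x v ⟨modifiedBracket C nabla τ υ x, h τ υ x⟩
    + extDerivOneForm I (nabla.pairing τ υ) x
        (C.anchor.toFun x ((σ : Cₛ^∞⟮I; F, V⟯) x)) v
    + extDerivOneForm I (nabla.pairing σ τ) x
        (C.anchor.toFun x ((υ : Cₛ^∞⟮I; F, V⟯) x)) v
    + extDerivOneForm I (nabla.pairing υ σ) x
        (C.anchor.toFun x ((τ : Cₛ^∞⟮I; F, V⟯) x)) v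
    + mvfderiv I (torsion C nabla σ τ υ) x v

/-- `(W, ∇)` is a pseudo-Dirac structure in the Courant algebroid: the modified bracket takes values
in sections of `W`, and `Ψ` vanishes. -/
structure IsPseudoDirac (C : CourantAlgebroid I F V) (W : Subbundle I F V)
    (nabla : PseudoConnection C.metric W) : Prop where
  bracket_closed : ModifiedBracketClosed C nabla
  psi_eq_zero : ∀ (σ τ υ : W.sections) (x : M) (v : TangentSpace I x),
    Psi C nabla bracket_closed σ τ υ x v = 0

end PseudoDirac

end

namespace PseudoDirac

/-! ### Exterior derivative of one-forms: d ∘ d = 0 on functions -/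

section

variable {E : Type*} [NormedAddCommGroup E] [NormedSpace ℝ E]
  {H : Type*} [TopologicalSpace H] {I : ModelWithCorners ℝ E H}
  {M : Type*} [TopologicalSpace M] [ChartedSpace H M]

/-! Let σ, τ be flat, β their Courant bracket and υ any section of W. Since ⟨∇σ, τ⟩ = 0, the
modified bracket of σ and τ is β, which therefore lies in Γ(W). In Ψ(σ, τ, υ) every term containing
∇σ or ∇τ vanishes. Metric compatibility gives ⟨∇υ, σ⟩ = d⟨υ, σ⟩, an exact form, so its exterior
derivative vanishes too (`extDerivOneForm_mvfderiv`). The torsion reduces to -⟨β, υ⟩. What remains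
of Ψ = 0 is ⟨β, ∇υ⟩ - d⟨β, υ⟩ = 0, and by metric compatibility the left side is -⟨∇β, υ⟩. Global
sections of W fill its fibres (`Subbundle.eval_surjective`), so ∇β = 0.

For the Lie algebra, d⟨σ, τ⟩ = 0 on flat sections kills the symmetric part of the Courant bracket,
and the Leibniz form of the Jacobi identity then becomes the cyclic one. -/

theorem extDerivOneForm_zero (x : M) (v w : TangentSpace I x) :
    extDerivOneForm I (0 : OneForm (M := M) I) x v w = 0 := by
  have h : OneForm.inChart I (0 : OneForm (M := M) I) x = 0 := by
    funext y
    exact ContinuousLinearMap.zero_comp _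
  simp [extDerivOneForm, h]

variable [IsManifold I ∞ M]

/-- The differential of a function, read in a chart, is the differential of the function read in
that chart. -/
theorem inChart_mvfderiv [I.Boundaryless] {f : M → ℝ} (hf : ContMDiff I 𝓘(ℝ, ℝ) ∞ f) (x : M)
    {y : E} (hy : y ∈ (extChartAt I x).target) :
    OneForm.inChart I (mvfderiv I f) x y = fderiv ℝ (f ∘ (extChartAt I x).symm) y := by
  have h := mvfderiv_comp_mfderivWithin (I := I) (I' := 𝓘(ℝ, E)) (s := Set.range I)
    (f := (extChartAt I x).symm) (g := f) y
    ((hf _).mdifferentiableAt (by simp)) (mdifferentiableWithinAt_extChartAt_symm hy)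
    (by rw [I.range_eq_univ]; exact uniqueMDiffWithinAt_univ _)
  refine h.symm.trans ?_
  rw [I.range_eq_univ, mvfderivWithin_univ]
  exact mfderiv_eq_fderiv

/-- Exact one-forms are closed. -/
theorem extDerivOneForm_mvfderiv [I.Boundaryless] {f : M → ℝ} (hf : ContMDiff I 𝓘(ℝ, ℝ) ∞ f)
    (x : M) (v w : TangentSpace I x) : extDerivOneForm I (mvfderiv I f) x v w = 0 := by
  -- The chart formula holds only on the chart's target, but the derivative at a point needs only
  -- the germ there.
  have heq : OneForm.inChart I (mvfderiv I f) x =ᶠ[𝓝 (extChartAt I x x)]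
      fderiv ℝ (f ∘ (extChartAt I x).symm) := by
    filter_upwards [extChartAt_target_mem_nhds (I := I) x] with y hy
    exact inChart_mvfderiv hf x hy
  have hsmooth : ContDiffAt ℝ ∞ (f ∘ (extChartAt I x).symm) (extChartAt I x x) := by
    rw [← contMDiffAt_iff_contDiffAt]
    refine (hf.contMDiffOn (s := Set.univ)).comp (contMDiffOn_extChartAt_symm x)
      (fun _ _ ↦ Set.mem_univ _) |>.contMDiffAt (extChartAt_target_mem_nhds x)
  -- In the chart, d(df) is the antisymmetrized second derivative of f, so Schwarz's theorem
  -- applies.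
  have hsymm := hsmooth.isSymmSndFDerivAt
    (by simpa using WithTop.coe_le_coe.2 (le_top : (2 : ℕ∞) ≤ ⊤))
  simp only [extDerivOneForm, I.range_eq_univ, fderivWithin_univ, heq.fderiv_eq]
  exact sub_eq_zero.2 (hsymm _ _)

end

/-! ### Metric pairing and flat sections -/

section

variable {E : Type*} [NormedAddCommGroup E] [NormedSpace ℝ E]
  {H : Type*} [TopologicalSpace H] {I : ModelWithCorners ℝ E H}
  {M : Type*} [TopologicalSpace M] [ChartedSpace H M]
  {F : Type*} [NormedAddCommGroup F] [NormedSpace ℝ F]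
  {V : M → Type*} [TopologicalSpace (Bundle.TotalSpace F V)]
  [∀ x, AddCommGroup (V x)] [∀ x, Module ℝ (V x)] [∀ x, TopologicalSpace (V x)]
  [FiberBundle F V] [VectorBundle ℝ F V]

/-- The pairing of two smooth sections is a smooth function. -/
theorem BundleMetric.contMDiff_pair (g : BundleMetric I F V) (σ τ : Cₛ^∞⟮I; F, V⟯) :
    ContMDiff I 𝓘(ℝ, ℝ) ∞ (g.pair σ τ) := by
  intro x
  have h : ContMDiffAt I (I.prod 𝓘(ℝ, ℝ)) ∞
      (fun y ↦ Bundle.TotalSpace.mk' ℝ (E := Bundle.Trivial M ℝ) y (g.form y (σ y) (τ y))) x :=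
    ContMDiffAt.clm_bundle_apply₂ (F₁ := F) (F₂ := F) (g.smooth x) (σ.contMDiff x) (τ.contMDiff x)
  exact (Bundle.contMDiffAt_totalSpace.1 h).2

theorem BundleMetric.mdifferentiableAt_pair (g : BundleMetric I F V) (σ τ : Cₛ^∞⟮I; F, V⟯)
    (x : M) : MDifferentiableAt I 𝓘(ℝ, ℝ) (g.pair σ τ) x :=
  (g.contMDiff_pair σ τ x).mdifferentiableAt (by simp)

theorem BundleMetric.pair_add_left (g : BundleMetric I F V) (σ σ' τ : Cₛ^∞⟮I; F, V⟯) :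
    g.pair (σ + σ') τ = g.pair σ τ + g.pair σ' τ := by
  ext x
  simp [BundleMetric.pair]

theorem BundleMetric.pair_smul_left (g : BundleMetric I F V) (c : ℝ) (σ τ : Cₛ^∞⟮I; F, V⟯) :
    g.pair (c • σ) τ = (fun _ ↦ c) * g.pair σ τ := by
  ext x
  simp [BundleMetric.pair]

variable [IsManifold I ∞ M]

theorem coanchor_zero [FiniteDimensional ℝ F] (g : BundleMetric I F V) (a : Anchor I F V) (x : M) :
    coanchor g a x 0 = 0 :=
  (g.toDual x).symm.map_zero

/-- The Courant bracket is skew on flat sections. -/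
theorem bracket_add_bracket_swap [FiniteDimensional ℝ F] {C : CourantAlgebroid I F V}
    {W : Subbundle I F V} {nabla : PseudoConnection C.metric W} {σ τ : W.sections}
    (hσ : nabla.toFun σ = 0) (hτ : nabla.toFun τ = 0) : C.bracket σ τ + C.bracket τ σ = 0 := by
  ext x
  -- Metric compatibility makes ⟨σ, τ⟩ have zero differential, so the right side of `c3` vanishes.
  have h : mvfderiv I (C.metric.pair σ τ) x = 0 := by
    ext v
    rw [nabla.metric_compat, hσ, hτ]
    simp
  exact (C.c3 σ τ x).trans ((congrArg _ h).trans (coanchor_zero _ _ _))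

variable [FiniteDimensional ℝ E]

namespace PseudoConnection

variable {g : BundleMetric I F V} {W : Subbundle I F V} {nabla : PseudoConnection g W}

/-- If `σ` is flat then `⟨∇τ, σ⟩ = d⟨τ, σ⟩`. -/
theorem pairing_eq_mvfderiv {σ : W.sections} (hσ : nabla.toFun σ = 0) (τ : W.sections) :
    nabla.pairing τ σ = mvfderiv I (g.pair τ σ) := by
  funext x
  ext v
  rw [nabla.pairing_apply, nabla.metric_compat τ σ x v, hσ]
  simp

theorem pairing_eq_zero {σ : W.sections} (hσ : nabla.toFun σ = 0) (τ : W.sections) :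
    nabla.pairing σ τ = 0 := by
  funext x
  ext v
  rw [nabla.pairing_apply, hσ]
  rfl

end PseudoConnection

section

variable [T2Space M]

/-- Every vector in a fibre of a subbundle is the value of a global smooth section. -/
theorem Subbundle.eval_surjective (W : Subbundle I F V) (x : M) :
    Function.Surjective fun σ : W.sections ↦ W.eval σ x := by
  obtain ⟨U, hU, hxU, k, s, hs, hspan⟩ := W.exists_frame x
  -- The values at x of global sections form a subspace, so it is enough to reach the frame vectors.
  suffices h : ∀ w ∈ Submodule.span ℝ (Set.range fun i ↦ s i x),
      ∃ σ : W.sections, (σ : Cₛ^∞⟮I; F, V⟯) x = w by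
    rintro ⟨w, hw⟩
    obtain ⟨σ, hσ⟩ := h w ((hspan x hxU).2 ▸ hw)
    exact ⟨σ, Subtype.ext hσ⟩
  intro w hw
  induction hw using Submodule.span_induction with
  | mem w hw =>
    obtain ⟨i, rfl⟩ := hw
    -- A bump function supported in U and equal to 1 at x extends the local frame section by zero.
    obtain ⟨ψ, -, hψ⟩ :=
      (SmoothBumpFunction.nhds_basis_tsupport (I := I) x).mem_iff.1 (hU.mem_nhds hxU)
    refine ⟨⟨⟨fun y ↦ ψ y • s i y,
      ContMDiffOn.smul_section_of_tsupport ψ.contMDiff.contMDiffOn hU hψ (hs i)⟩, fun y ↦ ?_⟩, ?_⟩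
    · by_cases hy : y ∈ U
      · exact (W.fiber y).smul_mem _
          ((hspan y hy).2 ▸ Submodule.subset_span (Set.mem_range_self i))
      · have : ψ y = 0 := image_eq_zero_of_notMem_tsupport fun h ↦ hy (hψ h)
        change ψ y • s i y ∈ W.fiber y
        rw [this, zero_smul]
        exact (W.fiber y).zero_mem
    · change ψ x • s i x = s i x
      rw [ψ.eq_one, one_smul]
  | zero => exact ⟨0, rfl⟩
  | add v w _ _ hv hw =>
    obtain ⟨σ, rfl⟩ := hv
    obtain ⟨τ, rfl⟩ := hw
    exact ⟨σ + τ, rfl⟩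
  | smul c w _ hw =>
    obtain ⟨σ, rfl⟩ := hw
    exact ⟨c • σ, rfl⟩

variable {g : BundleMetric I F V} {W : Subbundle I F V} (nabla : PseudoConnection g W)

/-- A section is flat if `⟨∇σ, τ⟩` vanishes for all sections `τ`. -/
theorem PseudoConnection.toFun_eq_zero_of_forall {σ : W.sections}
    (h : ∀ (τ : W.sections) (x : M) (v : TangentSpace I x),
      nabla.toFun σ x v (W.eval τ x) = 0) : nabla.toFun σ = 0 := by
  funext x
  refine LinearMap.ext fun v ↦ LinearMap.ext fun w ↦ ?_
  obtain ⟨τ, rfl⟩ := W.eval_surjective x w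
  exact h τ x v

/-- The flat sections form a vector space: metric compatibility forces `∇` to be additive. -/
def PseudoConnection.flatSections : Submodule ℝ W.sections where
  carrier := {σ | nabla.toFun σ = 0}
  zero_mem' := nabla.toFun_eq_zero_of_forall fun τ x v ↦ by
    have h := nabla.metric_compat 0 τ x v
    have h0 : g.pair (0 : W.sections) τ = 0 := by
      ext y
      simp [BundleMetric.pair]
    have h1 : W.eval 0 x = 0 := rfl
    rw [h0, mvfderiv_zero, h1, map_zero, add_zero] at h
    exact h.symm
  add_mem' {σ σ'} hσ hσ' := nabla.toFun_eq_zero_of_forall fun τ x v ↦ by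
    have h := nabla.metric_compat (σ + σ') τ x v
    have h₁ := nabla.metric_compat σ τ x v
    have h₂ := nabla.metric_compat σ' τ x v
    have he : W.eval (σ + σ') x = W.eval σ x + W.eval σ' x := rfl
    rw [show nabla.toFun σ = 0 from hσ] at h₁
    rw [show nabla.toFun σ' = 0 from hσ'] at h₂
    -- The ∇τ terms on both sides cancel, leaving ⟨∇(σ + σ'), τ⟩ = 0.
    rw [Submodule.coe_add, g.pair_add_left, mvfderiv_add (g.mdifferentiableAt_pair _ _ _)
      (g.mdifferentiableAt_pair _ _ _), add_apply, h₁, h₂, he, map_add] at h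
    simpa using h.symm
  smul_mem' c σ hσ := nabla.toFun_eq_zero_of_forall fun τ x v ↦ by
    have h := nabla.metric_compat (c • σ) τ x v
    have h₁ := nabla.metric_compat σ τ x v
    have he : W.eval (c • σ) x = c • W.eval σ x := rfl
    rw [show nabla.toFun σ = 0 from hσ] at h₁
    rw [Submodule.coe_smul, g.pair_smul_left, mvfderiv_mul mdifferentiableAt_const
      (g.mdifferentiableAt_pair _ _ _), mvfderiv_const, he, map_smul] at h
    simp only [smul_zero, add_zero, smul_apply, h₁] at h
    simpa using h.symm

end

/-! ### The Courant bracket on flat sections -/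

variable [FiniteDimensional ℝ F]

variable {C : CourantAlgebroid I F V} {W : Subbundle I F V} {nabla : PseudoConnection C.metric W}

/-- The modified bracket `[σ, τ]` is the Courant bracket if `σ` is flat. -/
theorem modifiedBracket_eq_bracket {σ : W.sections} (hσ : nabla.toFun σ = 0) (τ : W.sections)
    (x : M) : modifiedBracket C nabla σ τ x = C.bracket σ τ x := by
  have h : nabla.pairing σ τ x = 0 := congrFun (PseudoConnection.pairing_eq_zero hσ τ) x
  rw [modifiedBracket, h, coanchor_zero, sub_zero]

/-- Only the first argument has to be flat, since the correction term of the modified bracket is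
a^*⟨∇σ, τ⟩. -/
theorem bracket_mem_sections (h : ModifiedBracketClosed C nabla) {σ : W.sections}
    (hσ : nabla.toFun σ = 0) (τ : W.sections) : C.bracket σ τ ∈ W.sections := fun x ↦
  modifiedBracket_eq_bracket (nabla := nabla) hσ τ x ▸ h σ τ x

variable [T2Space M]

/-- The Courant bracket of flat sections of a pseudo-Dirac structure is flat. -/
theorem IsPseudoDirac.toFun_bracket [I.Boundaryless] (hW : IsPseudoDirac C W nabla)
    {σ τ : W.sections} (hσ : nabla.toFun σ = 0) (hτ : nabla.toFun τ = 0) :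
    nabla.toFun ⟨C.bracket σ τ, bracket_mem_sections hW.bracket_closed hσ τ⟩ = 0 := by
  refine nabla.toFun_eq_zero_of_forall fun υ x v ↦ ?_
  set β : W.sections := ⟨C.bracket σ τ, bracket_mem_sections hW.bracket_closed hσ τ⟩ with hβ
  have hT : torsion C nabla σ τ υ = -C.metric.pair β υ := by
    funext y
    rw [torsion, hσ, hτ, modifiedBracket_eq_bracket hσ]
    simp [BundleMetric.pair, hβ]
  have hm : (⟨modifiedBracket C nabla σ τ x, hW.bracket_closed σ τ x⟩ : W.fiber x) = W.eval β x :=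
    Subtype.ext (modifiedBracket_eq_bracket hσ τ x)
  have h := hW.psi_eq_zero σ τ υ x v
  -- Two of the one-forms under d are zero and the third, ⟨∇υ, σ⟩, is exact. Expanding d⟨β, υ⟩ by
  -- metric compatibility cancels ⟨β, ∇υ⟩.
  rw [Psi, hm, hT, PseudoConnection.pairing_eq_zero hτ, PseudoConnection.pairing_eq_zero hσ,
    PseudoConnection.pairing_eq_mvfderiv hσ, extDerivOneForm_zero, extDerivOneForm_zero,
    extDerivOneForm_mvfderiv (C.metric.contMDiff_pair _ _), hσ, hτ, mvfderiv_neg,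
    neg_apply, nabla.metric_compat] at h
  simp only [Pi.zero_apply, LinearMap.zero_apply] at h
  linarith

/-- The Courant bracket on the flat sections of a pseudo-Dirac structure. -/
noncomputable def IsPseudoDirac.flatBracket [I.Boundaryless] (hW : IsPseudoDirac C W nabla) :
    nabla.flatSections →ₗ[ℝ] nabla.flatSections →ₗ[ℝ] nabla.flatSections :=
  LinearMap.mk₂ ℝ
    (fun σ τ ↦ ⟨⟨C.bracket (σ : W.sections) (τ : W.sections),
      bracket_mem_sections hW.bracket_closed σ.2 τ⟩, hW.toFun_bracket σ.2 τ.2⟩)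
    (fun σ σ' τ ↦ Subtype.ext (Subtype.ext (by simp)))
    (fun c σ τ ↦ Subtype.ext (Subtype.ext (by simp)))
    (fun σ τ τ' ↦ Subtype.ext (Subtype.ext (by simp)))
    (fun c σ τ ↦ Subtype.ext (Subtype.ext (by simp)))

theorem IsPseudoDirac.coe_flatBracket [I.Boundaryless] (hW : IsPseudoDirac C W nabla)
    (σ τ : nabla.flatSections) :
    ((hW.flatBracket σ τ : W.sections) : Cₛ^∞⟮I; F, V⟯) =
      C.bracket (σ : W.sections) (τ : W.sections) :=
  rfl

theorem IsPseudoDirac.flatBracket_self [I.Boundaryless] (hW : IsPseudoDirac C W nabla)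
    (σ : nabla.flatSections) : hW.flatBracket σ σ = 0 := by
  refine Subtype.ext (Subtype.ext ?_)
  have h := bracket_add_bracket_swap (C := C) (nabla := nabla) σ.2 σ.2
  -- Skew-symmetry with both arguments equal says that twice the bracket is zero.
  rw [← two_smul ℝ, smul_eq_zero] at h
  exact h.resolve_left two_ne_zero

theorem IsPseudoDirac.flatBracket_jacobi [I.Boundaryless] (hW : IsPseudoDirac C W nabla)
    (σ τ υ : nabla.flatSections) :
    hW.flatBracket σ (hW.flatBracket τ υ) + hW.flatBracket τ (hW.flatBracket υ σ) +
      hW.flatBracket υ (hW.flatBracket σ τ) = 0 := by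
  have skew (α β : nabla.flatSections) : hW.flatBracket α β = -hW.flatBracket β α :=
    eq_neg_of_add_eq_zero_left <| Subtype.ext <| Subtype.ext <|
      bracket_add_bracket_swap (C := C) (nabla := nabla) α.2 β.2
  have leibniz : hW.flatBracket σ (hW.flatBracket τ υ) =
      hW.flatBracket (hW.flatBracket σ τ) υ + hW.flatBracket τ (hW.flatBracket σ υ) :=
    Subtype.ext <| Subtype.ext <| C.c1 _ _ _
  -- Skew-symmetry turns the two remaining cyclic terms into the negatives of the Leibniz terms.
  rw [leibniz, skew υ σ, skew υ (hW.flatBracket σ τ), map_neg]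
  abel

end

end PseudoDirac

theorem mainTheorem8
    {E : Type*} [NormedAddCommGroup E] [NormedSpace ℝ E] [FiniteDimensional ℝ E]
    {H : Type*} [TopologicalSpace H] {I : ModelWithCorners ℝ E H} [I.Boundaryless]
    {M : Type*} [TopologicalSpace M] [ChartedSpace H M] [IsManifold I ∞ M]
    [T2Space M] [SecondCountableTopology M]
    {F : Type*} [NormedAddCommGroup F] [NormedSpace ℝ F] [FiniteDimensional ℝ F]
    {V : M → Type*} [TopologicalSpace (Bundle.TotalSpace F V)]
    [∀ x, AddCommGroup (V x)] [∀ x, Module ℝ (V x)] [∀ x, TopologicalSpace (V x)]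
    [FiberBundle F V] [VectorBundle ℝ F V] [ContMDiffVectorBundle ∞ F V I]
    (C : PseudoDirac.CourantAlgebroid I F V) (W : PseudoDirac.Subbundle I F V)
    (nabla : PseudoDirac.PseudoConnection C.metric W)
    (hW : PseudoDirac.IsPseudoDirac C W nabla) :
    -- the Courant bracket of flat sections is their modified bracket, lies in `Γ(W)`, and is flat
    (∀ σ τ : W.sections, nabla.toFun σ = 0 → nabla.toFun τ = 0 →
      (∀ x, C.bracket σ τ x = PseudoDirac.modifiedBracket C nabla σ τ x) ∧
      ∃ h : C.bracket σ τ ∈ W.sections, nabla.toFun ⟨C.bracket σ τ, h⟩ = 0) ∧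
    -- the flat sections form a vector space, and a Lie algebra under the Courant bracket
    ∃ S : Submodule ℝ W.sections, (∀ σ : W.sections, σ ∈ S ↔ nabla.toFun σ = 0) ∧
      ∃ b : S →ₗ[ℝ] S →ₗ[ℝ] S,
        (∀ σ τ : S, ((b σ τ : W.sections) : Cₛ^∞⟮I; F, V⟯) =
          C.bracket (σ : W.sections) (τ : W.sections)) ∧
        (∀ σ : S, b σ σ = 0) ∧
        ∀ σ τ υ : S, b σ (b τ υ) + b τ (b υ σ) + b υ (b σ τ) = 0 := by
  refine ⟨fun σ τ hσ hτ ↦ ⟨fun x ↦ (PseudoDirac.modifiedBracket_eq_bracket hσ τ x).symm,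
    PseudoDirac.bracket_mem_sections hW.bracket_closed hσ τ, hW.toFun_bracket hσ hτ⟩,
    nabla.flatSections, fun _ ↦ Iff.rfl, hW.flatBracket, hW.coe_flatBracket,
    hW.flatBracket_self, hW.flatBracket_jacobi⟩
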